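/- Call a sequence $\langle f_n\rangle$ of polynomials weakly convergent to a formal power series $f=\sum_{k\ge 0} c_k z^k\in\mathbb C[[z]]$ if $\lim_{n\to\infty} f_n^{(k)}(0)/k! = c_k$ for every integer $k\ge 0$. For a polynomial $h$ with $h(0)\neq 0$ and zeros $a_1,\dots,a_d$, listed according to multiplicity, put $\tilde s_p(h)=\sum_{j=1}^{d}|a_j|^{-p}$. An entire function $g\not\equiv 0$ with nonzero zeros $a_1,a_2,\dots$ (finitely or infinitely many, listed according to multiplicity) has genus $q$ if there is a least integer $h\ge 0$ with $\sum_j |a_j|^{-(h+1)}<\infty$, and $$g(z)=z^m e^{Q(z)}\prod_j\Bigl(1-\frac{z}{a_j}\Bigr)\exp\Bigl(\sum_{k=1}^{h}\frac1k\Bigl(\frac{z}{a_j}\Bigr)^k\Bigr)\qquad(z\in\mathbb C)$$ for this $h$, where $m\ge 0$ is the order of vanishing of $g$ at $0$ and $Q$ is a polynomial, and $q=\max(\deg Q,h)$ (with $\deg Q=0$ for constant $Q$). **Theorem 2.3.** Let $p$ be a positive integer, let $M>0$, and let $\langle f_n\rangle$ be a sequence of polynomials with complex coefficients such that $f_n(0)\ne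 0$ for all $n$, $\lim_{n\to\infty}f_n(0)$ exists and is not $0$, $f_n\to f$ weakly for a formal power series $f$, and $\tilde s_p(f_n)\le M$ for all $n$. Then $f$ has infinite radius of convergence, so that it represents an entire function (again denoted by $f$), $f_n\to f$ uniformly on every compact subset of $\mathbb C$, and there are a constant $\alpha\in\mathbb C$ and an entire function $g$ of genus at most $p-1$ such that $$f(z)=e^{\alpha z^p}g(z)\qquad(z\in\mathbb C).$$ -/

import Mathlib

open Filter Topology

/-- A sequence `F` of functions analytic at `0` converges weakly to the formal power series `f`:
for every `k` the sequence `F n ^ (k) (0) / k!` converges to the `k`-th coefficient of `f`. -/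
def ConvergesWeakly (F : ℕ → ℂ → ℂ) (f : PowerSeries ℂ) : Prop :=
  ∀ k : ℕ, Tendsto (fun n => (1 / (Nat.factorial k : ℂ)) * iteratedDeriv k (F n) 0) atTop
    (𝓝 (PowerSeries.coeff k f))

/-- Strong convergence: uniform convergence on every compact set of the complex plane. -/
def ConvergesStrongly (F : ℕ → ℂ → ℂ) (G : ℂ → ℂ) : Prop :=
  ∀ K : Set ℂ, IsCompact K → TendstoUniformlyOn F G atTop K

/-- The formal power series `f` represents the entire function `F`. -/
def RepresentsEntire (f : PowerSeries ℂ) (F : ℂ → ℂ) : Prop :=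
  Differentiable ℂ F ∧ ∀ z : ℂ, HasSum (fun k : ℕ => PowerSeries.coeff k f * z ^ k) (F z)

/-- For a polynomial `P` with `P(0) ≠ 0`: the sum of `|a|⁻ᵏ` over the zeros `a` of `P`, counted
with multiplicity. -/
noncomputable def absZeroPowerSum (k : ℕ) (P : Polynomial ℂ) : ℝ :=
  (P.roots.map fun a => (‖a‖ ^ k)⁻¹).sum

/-- The Weierstrass elementary factor
`E_h(z) = (1 - z) exp (z + z ^ 2 / 2 + ⋯ + z ^ h / h)`. -/
noncomputable def elementaryFactor (h : ℕ) (z : ℂ) : ℂ :=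
  (1 - z) * Complex.exp (∑ j ∈ Finset.Icc 1 h, z ^ j / (j : ℂ))

/-- The set of nonzero zeros of `f`. -/
def nonzeroZeros (f : ℂ → ℂ) : Set ℂ := {a | f a = 0 ∧ a ≠ 0}

/-- The sum of `|a|⁻ᵏ` over the nonzero zeros `a` of `f`, each repeated according to its
multiplicity (the order of vanishing of `f` at `a`), is finite. -/
def ZeroPowersSummable (f : ℂ → ℂ) (k : ℕ) : Prop :=
  Summable fun a : nonzeroZeros f => (analyticOrderNatAt f (a : ℂ) : ℝ) * (‖(a : ℂ)‖ ^ k)⁻¹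

/-- The entire function `f` (not identically zero) has genus `q`: if `h` is the least natural
number for which the sum of `|a|^{-(h+1)}` over the nonzero zeros `a` of `f` (with multiplicity)
is finite, then `f(z) = z^m e^{Q(z)} ∏ E_h(z / a)`, where `m` is the order of vanishing of `f` at
`0`, `Q` is a polynomial, and `a` runs through the nonzero zeros with multiplicity; and
`q = max (deg Q) h`. The zero function has no genus, since the right side of the factorization
does not vanish identically. -/
def HasGenus (f : ℂ → ℂ) (q : ℕ) : Prop :=
  Differentiable ℂ f ∧
  ∃ (h : ℕ) (Q : Polynomial ℂ) (Pi : ℂ → ℂ),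
    IsLeast {l : ℕ | ZeroPowersSummable f (l + 1)} h ∧
    (∀ z : ℂ, HasProd
      (fun a : nonzeroZeros f =>
        elementaryFactor h (z / (a : ℂ)) ^ analyticOrderNatAt f (a : ℂ)) (Pi z)) ∧
    (∀ z : ℂ, f z = z ^ analyticOrderNatAt f 0 * Complex.exp (Q.eval z) * Pi z) ∧
    q = max Q.natDegree h

/-! Write `P n` through its inverse zeros `b n j`, listed by decreasing modulus and padded with
zeros. Extracting exponentials gives `P n (z) = P n (0) · exp (-∑_{k ≤ p} s_k z^k / k) · ∏ E_p (b n
j · z)`, where `s_k` is the `k`-th power sum of the inverse zeros. Each ingredient is controlled. By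
Newton's identities the `s_k` converge, because the coefficients do and the constant terms stay away
from `0`. The monotone listing turns `∑ |b n j|^p ≤ M` into `(j + 1) |b n j|^p ≤ M`, so all rows lie
under one majorant of order `j^(-1/p)`. Its `p`-th powers are not summable but its `(p + 1)`-th
powers are, which is why `E_p` is used rather than `E_{p-1}`.

Hence the `P n` are locally bounded, and Cauchy's estimates upgrade weak to strong convergence. By
compactness a subsequence of rows converges entrywise to some `β` with `∑ |β j|^p ≤ M`, and
dominated convergence of products gives `F = e^Q ∏ E_p (β j · z)` with `deg Q ≤ p`. Passing from
`E_p` to the least admissible `E_h`, `h ≤ p - 1`, costs only a polynomial of degree at most `p` in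
the exponent, and its `z^p` term is split off. The coefficient is `α = (∑ β_j^p - lim s_p) / p`, the
part of the `p`-th power sum lost in the limit. -/

/-! ### Elementary factors. -/

lemma elementaryFactor_zero (h : ℕ) : elementaryFactor h 0 = 1 := by
  have : ∑ j ∈ Finset.Icc 1 h, (0 : ℂ) ^ j / (j : ℂ) = 0 := by
    refine Finset.sum_eq_zero fun j hj => ?_
    have : j ≠ 0 := by have := (Finset.mem_Icc.mp hj).1; omega
    simp [this]
  simp [elementaryFactor, this]

lemma elementaryFactor_eq_zero_iff (h : ℕ) (w : ℂ) : elementaryFactor h w = 0 ↔ w = 1 := by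
  rw [elementaryFactor, mul_eq_zero, or_iff_left (Complex.exp_ne_zero _), sub_eq_zero, eq_comm]

lemma hasDerivAt_elementaryFactor (h : ℕ) (w : ℂ) :
    HasDerivAt (elementaryFactor h)
      (-(w ^ h * Complex.exp (∑ j ∈ Finset.Icc 1 h, w ^ j / (j : ℂ)))) w := by
  have hsum : HasDerivAt (fun w : ℂ => ∑ j ∈ Finset.Icc 1 h, w ^ j / (j : ℂ))
      (∑ i ∈ Finset.range h, w ^ i) w := by
    have : ∑ i ∈ Finset.range h, w ^ i
        = ∑ j ∈ Finset.Icc 1 h, ((j : ℂ) * w ^ (j - 1)) / (j : ℂ) := by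
      rw [← Finset.Ico_add_one_right_eq_Icc, Finset.sum_Ico_eq_sum_range]
      refine Finset.sum_congr rfl fun i _ => ?_
      have : ((1 + i : ℕ) : ℂ) ≠ 0 := by exact_mod_cast (by omega)
      rw [mul_div_cancel_left₀ _ this]
      simp
    rw [this]
    exact HasDerivAt.fun_sum fun j _ => (hasDerivAt_pow j w).div_const _
  have h1 : HasDerivAt (fun w : ℂ => 1 - w) (-1) w := by
    simpa using (hasDerivAt_id w).const_sub 1
  have := h1.mul hsum.cexp
  refine this.congr_deriv ?_
  -- The geometric sum telescopes: `-1 + (1 - w) ∑_{i < h} w^i = -w^h`.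
  have hg := mul_neg_geom_sum w h
  linear_combination (Complex.exp (∑ j ∈ Finset.Icc 1 h, w ^ j / (j : ℂ))) * hg

lemma differentiable_elementaryFactor (h : ℕ) : Differentiable ℂ (elementaryFactor h) :=
  fun w => (hasDerivAt_elementaryFactor h w).differentiableAt

/-- `E_h(w) - 1` vanishes to order `h + 1` at the origin, uniformly on bounded sets. -/
lemma exists_norm_elementaryFactor_sub_one_le (h : ℕ) (R : ℝ) :
    ∃ C : ℝ, 0 ≤ C ∧ ∀ w : ℂ, ‖w‖ ≤ R → ‖elementaryFactor h w - 1‖ ≤ C * ‖w‖ ^ (h + 1) := by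
  have hcont : Continuous fun w : ℂ => Complex.exp (∑ j ∈ Finset.Icc 1 h, w ^ j / (j : ℂ)) := by
    fun_prop
  obtain ⟨C, hC⟩ := (isCompact_closedBall (0 : ℂ) R).exists_bound_of_continuousOn hcont.continuousOn
  refine ⟨max C 0, le_max_right _ _, fun w hw => ?_⟩
  have key := (convex_closedBall (0 : ℂ) ‖w‖).norm_image_sub_le_of_norm_hasDerivWithin_le
    (f := elementaryFactor h) (C := max C 0 * ‖w‖ ^ h)
    (fun x _ => (hasDerivAt_elementaryFactor h x).hasDerivWithinAt) (fun x hx => ?_)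
    (x := 0) (y := w) (by simp) (by simp)
  · rw [elementaryFactor_zero, sub_zero] at key
    calc _ ≤ _ := key
      _ = _ := by ring
  · rw [mem_closedBall_zero_iff] at hx
    rw [norm_neg, norm_mul, norm_pow, mul_comm]
    have := hC x (mem_closedBall_zero_iff.mpr (hx.trans hw))
    gcongr
    exact this.trans (le_max_left _ _)

lemma elementaryFactor_eq_mul_exp {h H : ℕ} (hH : h ≤ H) (w : ℂ) :
    elementaryFactor H w =
      elementaryFactor h w * Complex.exp (∑ k ∈ Finset.Ioc h H, w ^ k / (k : ℂ)) := by
  rw [elementaryFactor, elementaryFactor, mul_assoc, ← Complex.exp_add]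
  congr 2
  rw [← Finset.sum_union]
  · congr 1
    ext k
    simp only [Finset.mem_union, Finset.mem_Icc, Finset.mem_Ioc]
    omega
  · rw [Finset.disjoint_left]
    intro k
    simp only [Finset.mem_Icc, Finset.mem_Ioc]
    omega

/-! ### Canonical products: convergence, holomorphy, zeros. -/

section CanonicalProduct

variable {b : ℕ → ℂ} {h : ℕ}

lemma exists_norm_le_of_summable_pow (hb : Summable fun j => ‖b j‖ ^ (h + 1)) :
    ∃ B : ℝ, 0 ≤ B ∧ ∀ j, ‖b j‖ ≤ B := by
  refine ⟨max 1 (∑' j, ‖b j‖ ^ (h + 1)), by positivity, fun j => ?_⟩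
  by_cases h1 : ‖b j‖ ≤ 1
  · exact h1.trans (le_max_left _ _)
  · push Not at h1
    refine le_trans ?_ (le_max_right _ _)
    exact (le_self_pow₀ h1.le (by omega)).trans
      (hb.le_tsum j fun i _ => by positivity)

lemma summable_pow_of_le (hb : Summable fun j => ‖b j‖ ^ (h + 1)) {k : ℕ} (hk : h + 1 ≤ k) :
    Summable fun j => ‖b j‖ ^ k := by
  obtain ⟨B, hB, hbB⟩ := exists_norm_le_of_summable_pow hb
  refine Summable.of_nonneg_of_le (fun j => by positivity) (fun j => ?_)
    (hb.mul_left (B ^ (k - (h + 1))))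
  calc ‖b j‖ ^ k = ‖b j‖ ^ (k - (h + 1)) * ‖b j‖ ^ (h + 1) := by rw [← pow_add]; congr 1; omega
    _ ≤ _ := by gcongr; exact hbB j

/-- The bound is for every `w` of modulus at most `‖b j‖ * |R|`, not just `w = b j * z`, so that a
majorant in place of `b` serves all sequences below it at once. -/
lemma exists_summable_bound_elementaryFactor (hb : Summable fun j => ‖b j‖ ^ (h + 1)) (R : ℝ) :
    ∃ u : ℕ → ℝ, Summable u ∧ ∀ j, ∀ w : ℂ, ‖w‖ ≤ ‖b j‖ * |R| →
      ‖elementaryFactor h w - 1‖ ≤ u j := by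
  obtain ⟨B, hB, hbB⟩ := exists_norm_le_of_summable_pow hb
  obtain ⟨C, hC0, hC⟩ := exists_norm_elementaryFactor_sub_one_le h (B * |R|)
  refine ⟨fun j => C * |R| ^ (h + 1) * ‖b j‖ ^ (h + 1), hb.mul_left _,
    fun j w hw => ?_⟩
  refine (hC _ (hw.trans (by gcongr; exact hbB j))).trans ?_
  calc C * ‖w‖ ^ (h + 1) ≤ C * (‖b j‖ * |R|) ^ (h + 1) := by gcongr
    _ = C * |R| ^ (h + 1) * ‖b j‖ ^ (h + 1) := by ring

/-- The canonical product `∏ E_h(b_j z)`, in terms of the inverses `b_j` of its zeros. -/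
noncomputable def canonicalProduct (h : ℕ) (b : ℕ → ℂ) (z : ℂ) : ℂ :=
  ∏' j, elementaryFactor h (b j * z)

lemma canonicalProduct_eq_tprod_one_add (h : ℕ) (b : ℕ → ℂ) (z : ℂ) :
    canonicalProduct h b z = ∏' j, (1 + (elementaryFactor h (b j * z) - 1)) := by
  simp [canonicalProduct]

lemma summable_norm_elementaryFactor_sub_one (hb : Summable fun j => ‖b j‖ ^ (h + 1)) (z : ℂ) :
    Summable fun j => ‖elementaryFactor h (b j * z) - 1‖ := by
  obtain ⟨u, hu, hub⟩ := exists_summable_bound_elementaryFactor hb ‖z‖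
  exact Summable.of_nonneg_of_le (fun _ => norm_nonneg _)
    (fun j => hub j _ (by rw [norm_mul, abs_norm])) hu

lemma hasProd_canonicalProduct (hb : Summable fun j => ‖b j‖ ^ (h + 1)) (z : ℂ) :
    HasProd (fun j => elementaryFactor h (b j * z)) (canonicalProduct h b z) := by
  have := multipliable_one_add_of_summable (summable_norm_elementaryFactor_sub_one hb z)
  simp only [add_sub_cancel] at this
  exact this.hasProd

lemma differentiable_canonicalProduct (hb : Summable fun j => ‖b j‖ ^ (h + 1)) :
    Differentiable ℂ (canonicalProduct h b) := by
  intro z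
  obtain ⟨u, hu, hub⟩ := exists_summable_bound_elementaryFactor hb (‖z‖ + 1)
  have hopen : IsOpen (Metric.ball (0 : ℂ) (‖z‖ + 1)) := Metric.isOpen_ball
  have hd : ∀ j, Differentiable ℂ fun z => elementaryFactor h (b j * z) := fun j =>
    (differentiable_elementaryFactor h).comp (differentiable_id.const_mul (b j))
  have H := Summable.hasProdLocallyUniformlyOn_one_add
    (f := fun j z => elementaryFactor h (b j * z) - 1) hopen hu
    (Eventually.of_forall fun j x hx => hub j _ <| by
      rw [norm_mul, abs_of_nonneg (by positivity)]
      gcongr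
      exact (mem_ball_zero_iff.mp hx).le)
    (fun j => ((hd j).continuous.sub continuous_const).continuousOn)
  simp only [add_sub_cancel] at H
  rw [hasProdLocallyUniformlyOn_iff_tendstoLocallyUniformlyOn] at H
  refine (TendstoLocallyUniformlyOn.differentiableOn H (Eventually.of_forall fun s => ?_)
    hopen).differentiableAt (hopen.mem_nhds (by simp))
  exact DifferentiableOn.fun_finsetProd fun j _ => (hd j).differentiableOn

lemma canonicalProduct_ne_zero (hb : Summable fun j => ‖b j‖ ^ (h + 1)) {z : ℂ}
    (hz : ∀ j, b j * z ≠ 1) : canonicalProduct h b z ≠ 0 := by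
  rw [canonicalProduct_eq_tprod_one_add]
  refine tprod_one_add_ne_zero_of_summable (fun j => ?_)
    (summable_norm_elementaryFactor_sub_one hb z)
  rw [add_sub_cancel, Ne, elementaryFactor_eq_zero_iff]
  exact hz j

/-- Raising the genus of a canonical product only changes it by the exponential of a polynomial. -/
lemma exists_canonicalProduct_eq_exp_mul {H : ℕ} (hb : Summable fun j => ‖b j‖ ^ (h + 1))
    (hH : h ≤ H) : ∃ Q : Polynomial ℂ, Q.natDegree ≤ H ∧ ∀ z,
      canonicalProduct H b z = Complex.exp (Q.eval z) * canonicalProduct h b z := by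
  have hs : ∀ k ∈ Finset.Ioc h H, Summable fun j => b j ^ k := fun k hk => by
    refine Summable.of_norm ?_
    simpa using summable_pow_of_le hb (k := k) (by have := Finset.mem_Ioc.mp hk; omega)
  refine ⟨∑ k ∈ Finset.Ioc h H, Polynomial.monomial k ((∑' j, b j ^ k) / (k : ℂ)), ?_, fun z => ?_⟩
  · refine Polynomial.natDegree_sum_le_of_forall_le _ _ fun k hk => ?_
    exact (Polynomial.natDegree_monomial_le _).trans (Finset.mem_Ioc.mp hk).2
  · have hsum : HasSum (fun j => ∑ k ∈ Finset.Ioc h H, (b j * z) ^ k / (k : ℂ))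
        ((∑ k ∈ Finset.Ioc h H, Polynomial.monomial k ((∑' j, b j ^ k) / (k : ℂ))).eval z) := by
      rw [Polynomial.eval_finsetSum]
      refine hasSum_sum fun k hk => ?_
      have := ((hs k hk).hasSum.mul_right (z ^ k / (k : ℂ)))
      rw [Polynomial.eval_monomial]
      simpa only [mul_pow, mul_div_assoc, div_mul_eq_mul_div] using this
    have := hsum.cexp.mul (hasProd_canonicalProduct hb z)
    rw [← this.tprod_eq, canonicalProduct]
    refine tprod_congr fun j => ?_
    rw [elementaryFactor_eq_mul_exp hH, mul_comm]; rfl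

end CanonicalProduct

/-! ### Zeros with multiplicity, and the genus of `e^Q` times a canonical product. -/

section Genus

variable {b : ℕ → ℂ} {h : ℕ}

lemma finite_setOf_eq_of_summable_pow (hb : Summable fun j => ‖b j‖ ^ (h + 1)) {w : ℂ}
    (hw : w ≠ 0) : {j | b j = w}.Finite := by
  have hpos : 0 < ‖w‖ ^ (h + 1) := by positivity
  have := hb.tendsto_cofinite_zero.eventually_lt_const hpos
  refine (Filter.eventually_cofinite.mp this).subset fun j hj => ?_
  rw [Set.mem_ofPred_eq] at hj
  simp [hj]

lemma analyticOrderNatAt_exp_mul_canonicalProduct (hb : Summable fun j => ‖b j‖ ^ (h + 1))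
    (Q : Polynomial ℂ) {a : ℂ} (ha : a ≠ 0) :
    analyticOrderNatAt (fun z => Complex.exp (Q.eval z) * canonicalProduct h b z) a
      = {j | b j = a⁻¹}.ncard := by
  classical
  have hfin := finite_setOf_eq_of_summable_pow hb (inv_ne_zero ha)
  set S : Finset ℕ := hfin.toFinset with hS
  have hmem : ∀ j, j ∈ S ↔ b j = a⁻¹ := fun j => by simp [hS]
  -- Replacing an entry by `0` deletes its factor, since `E_h(0) = 1`; the finitely many factors
  -- vanishing at `a` are thus separated from a product that does not vanish there.
  set b' : ℕ → ℂ := fun j => if j ∈ S then 0 else b j with hb'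
  have hb's : Summable fun j => ‖b' j‖ ^ (h + 1) := by
    refine Summable.of_nonneg_of_le (fun j => by positivity) (fun j => ?_) hb
    by_cases hj : j ∈ S
    · simp [hb', hj]
    · simp [hb', hj]
  have hsplit : ∀ z, canonicalProduct h b z
      = canonicalProduct h b' z * elementaryFactor h (a⁻¹ * z) ^ S.card := fun z => by
    have h1 := hasProd_canonicalProduct hb's z
    have h2 : HasProd (fun j => if j ∈ S then elementaryFactor h (b j * z) else 1)
        (∏ j ∈ S, if j ∈ S then elementaryFactor h (b j * z) else 1) :=
      hasProd_prod_of_ne_finset_one fun j hj => by simp [hj]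
    have h3 : (∏ j ∈ S, if j ∈ S then elementaryFactor h (b j * z) else 1)
        = elementaryFactor h (a⁻¹ * z) ^ S.card := by
      rw [← Finset.prod_const]
      exact Finset.prod_congr rfl fun j hj => by rw [if_pos hj, (hmem j).mp hj]
    rw [← h3, ← (h1.mul h2).tprod_eq]
    refine tprod_congr fun j => ?_
    by_cases hj : j ∈ S
    · simp [hb', hj, elementaryFactor_zero]
    · simp [hb', hj]
  have hdiff : Differentiable ℂ fun z => Complex.exp (Q.eval z) * canonicalProduct h b z :=
    (Q.differentiable.cexp).mul (differentiable_canonicalProduct hb)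
  have horder : analyticOrderAt (fun z => Complex.exp (Q.eval z) * canonicalProduct h b z) a
      = (S.card : ℕ) := by
    rw [(hdiff.analyticAt a).analyticOrderAt_eq_natCast]
    refine ⟨fun z => Complex.exp (Q.eval z) * canonicalProduct h b' z *
      (-a⁻¹ * Complex.exp (∑ j ∈ Finset.Icc 1 h, (a⁻¹ * z) ^ j / (j : ℂ))) ^ S.card, ?_, ?_, ?_⟩
    · refine Differentiable.analyticAt (Differentiable.mul (Q.differentiable.cexp.mul
        (differentiable_canonicalProduct hb's)) ?_) a
      fun_prop
    · refine mul_ne_zero (mul_ne_zero (Complex.exp_ne_zero _)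
        (canonicalProduct_ne_zero hb's fun j hj => ?_)) (pow_ne_zero _ (mul_ne_zero (by simpa)
        (Complex.exp_ne_zero _)))
      have h1 : b' j = a⁻¹ := eq_inv_of_mul_eq_one_left hj
      by_cases hjS : j ∈ S
      · rw [hb'] at h1
        simp only [hjS, if_true] at h1
        exact inv_ne_zero ha h1.symm
      · simp only [hb', hjS, if_false] at h1
        exact hjS ((hmem j).mpr h1)
    · refine Eventually.of_forall fun z => ?_
      have : elementaryFactor h (a⁻¹ * z) = (z - a) *
          (-a⁻¹ * Complex.exp (∑ j ∈ Finset.Icc 1 h, (a⁻¹ * z) ^ j / (j : ℂ))) := by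
        rw [elementaryFactor]
        field_simp
        ring
      simp only [smul_eq_mul]
      rw [hsplit, this, mul_pow]
      ring
  rw [Set.ncard_eq_toFinset_card _ hfin, analyticOrderNatAt, horder, ENat.toNat_natCast]

lemma exp_mul_canonicalProduct_eq_zero_iff (hb : Summable fun j => ‖b j‖ ^ (h + 1))
    (Q : Polynomial ℂ) {z : ℂ} :
    Complex.exp (Q.eval z) * canonicalProduct h b z = 0 ↔ ∃ j, b j * z = 1 := by
  constructor
  · intro hz
    by_contra! hne
    exact mul_ne_zero (Complex.exp_ne_zero _) (canonicalProduct_ne_zero hb hne) hz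
  · rintro ⟨j, hj⟩
    rw [canonicalProduct, tprod_of_exists_eq_zero ⟨j, ?_⟩, mul_zero]
    rw [hj, elementaryFactor_eq_zero_iff]

/-- The zero `1 / b_j` of the function `e^Q ∏ E_h(b_j z)` attached to an index `j` with
`b_j ≠ 0`. -/
noncomputable def zeroOfIndex (hb : Summable fun j => ‖b j‖ ^ (h + 1)) (Q : Polynomial ℂ)
    (j : {j // b j ≠ 0}) :
    nonzeroZeros (fun z => Complex.exp (Q.eval z) * canonicalProduct h b z) :=
  ⟨(b j)⁻¹, (exp_mul_canonicalProduct_eq_zero_iff hb Q).mpr ⟨j, mul_inv_cancel₀ j.2⟩,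
    inv_ne_zero j.2⟩

lemma zeroOfIndex_eq_iff (hb : Summable fun j => ‖b j‖ ^ (h + 1)) (Q : Polynomial ℂ)
    (j : {j // b j ≠ 0})
    (a : nonzeroZeros (fun z => Complex.exp (Q.eval z) * canonicalProduct h b z)) :
    zeroOfIndex hb Q j = a ↔ b j = (a : ℂ)⁻¹ := by
  rw [Subtype.ext_iff, zeroOfIndex, inv_eq_iff_eq_inv]

lemma card_fiber_zeroOfIndex (hb : Summable fun j => ‖b j‖ ^ (h + 1)) (Q : Polynomial ℂ)
    (a : nonzeroZeros (fun z => Complex.exp (Q.eval z) * canonicalProduct h b z)) :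
    Finite (zeroOfIndex hb Q ⁻¹' {a}) ∧ Nat.card (zeroOfIndex hb Q ⁻¹' {a})
      = analyticOrderNatAt (fun z => Complex.exp (Q.eval z) * canonicalProduct h b z) a := by
  have ha : (a : ℂ) ≠ 0 := a.2.2
  have himage : Subtype.val '' (zeroOfIndex hb Q ⁻¹' {a}) = {j | b j = (a : ℂ)⁻¹} := by
    ext j
    simp only [Set.mem_image, Set.mem_preimage, Set.mem_singleton_iff, zeroOfIndex_eq_iff,
      Subtype.exists, exists_and_left, exists_prop, exists_eq_right_right, Set.mem_ofPred_eq]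
    exact ⟨fun hj => hj.1, fun hj => ⟨hj, hj ▸ inv_ne_zero ha⟩⟩
  constructor
  · refine Set.Finite.of_finite_image ?_ Subtype.val_injective.injOn
    rw [himage]
    exact finite_setOf_eq_of_summable_pow hb (inv_ne_zero ha)
  · rw [analyticOrderNatAt_exp_mul_canonicalProduct hb Q ha, ← himage,
      Set.ncard_image_of_injective _ Subtype.val_injective, Set.ncard_def, Set.encard]
    rfl

/-- Grouping equal factors turns a product over indices into one over distinct zeros, with
multiplicities as exponents. -/
lemma HasProd.pow_card_fiber {α β : Type*} {f : α → ℂ} {P : ℂ} (hf : HasProd f P) (m : α → β)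
    (hm : ∀ c, Finite (m ⁻¹' {c})) (F : β → ℂ) (hF : ∀ j, f j = F (m j)) :
    HasProd (fun c => F c ^ Nat.card (m ⁻¹' {c})) P := by
  refine ((Equiv.sigmaFiberEquiv m).hasProd_iff.mpr hf).sigma fun c => ?_
  have : Finite {j // m j = c} := hm c
  have := Fintype.ofFinite {j // m j = c}
  have hcard : Nat.card (m ⁻¹' {c}) = Fintype.card {j // m j = c} :=
    Nat.card_eq_fintype_card (α := {j // m j = c})
  rw [hcard, ← Finset.card_univ, ← Finset.prod_const]
  convert hasProd_fintype _ using 2 with j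
  exact ((hF j).trans (by rw [j.2])).symm

lemma hasProd_zeros (hb : Summable fun j => ‖b j‖ ^ (h + 1)) (Q : Polynomial ℂ) (z : ℂ) :
    HasProd (fun a : nonzeroZeros (fun z => Complex.exp (Q.eval z) * canonicalProduct h b z) =>
      elementaryFactor h (z / (a : ℂ)) ^
        analyticOrderNatAt (fun z => Complex.exp (Q.eval z) * canonicalProduct h b z) (a : ℂ))
      (canonicalProduct h b z) := by
  have h1 : HasProd (fun j : {j // b j ≠ 0} => elementaryFactor h (b j * z))
      (canonicalProduct h b z) := by
    refine (Subtype.val_injective.hasProd_iff (f := fun j => elementaryFactor h (b j * z))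
      fun j hj => ?_).mpr (hasProd_canonicalProduct hb z)
    have h0 : b j = 0 := by simpa using hj
    rw [h0, zero_mul, elementaryFactor_zero]
  have h2 := h1.pow_card_fiber (zeroOfIndex hb Q) (fun a => (card_fiber_zeroOfIndex hb Q a).1)
    (fun a => elementaryFactor h (z / (a : ℂ))) fun j => by
      rw [(zeroOfIndex_eq_iff hb Q j _).mp rfl, ← div_eq_inv_mul]
  simpa only [(card_fiber_zeroOfIndex hb Q _).2] using h2

/-- The terms are nonnegative, so they may be summed fibre by fibre over the zeros. With `k ≠ 0` the
padding entries `b j = 0` contribute nothing. -/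
lemma zeroPowersSummable_iff (hb : Summable fun j => ‖b j‖ ^ (h + 1)) (Q : Polynomial ℂ) {k : ℕ}
    (hk : k ≠ 0) :
    ZeroPowersSummable (fun z => Complex.exp (Q.eval z) * canonicalProduct h b z) k ↔
      Summable fun j => ‖b j‖ ^ k := by
  have h1 : (Summable fun j : {j // b j ≠ 0} => ‖b j‖ ^ k) ↔ Summable fun j => ‖b j‖ ^ k := by
    refine Subtype.val_injective.summable_iff (f := fun j => ‖b j‖ ^ k) fun j hj => ?_
    have h0 : b j = 0 := by simpa using hj
    simp [h0, hk]
  rw [← h1, ← (Equiv.sigmaFiberEquiv (zeroOfIndex hb Q)).summable_iff,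
    summable_sigma_of_nonneg (fun _ => by simp only [Function.comp]; positivity)]
  have hfib : ∀ (a : nonzeroZeros (fun z => Complex.exp (Q.eval z) * canonicalProduct h b z))
      (j : {j // zeroOfIndex hb Q j = a}), ‖b (j : {j // b j ≠ 0})‖ ^ k = (‖(a : ℂ)‖ ^ k)⁻¹ :=
    fun a j => by rw [(zeroOfIndex_eq_iff hb Q j a).mp j.2, norm_inv, inv_pow]
  have hfinite : ∀ a, Finite {j // zeroOfIndex hb Q j = a} := fun a =>
    (card_fiber_zeroOfIndex hb Q a).1
  rw [and_iff_right fun a => have := hfinite a; Summable.of_finite, ZeroPowersSummable]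
  refine summable_congr fun a => ?_
  have := Fintype.ofFinite {j // zeroOfIndex hb Q j = a}
  rw [tsum_fintype, ← (card_fiber_zeroOfIndex hb Q a).2, ← nsmul_eq_mul]
  have hcard : Nat.card (zeroOfIndex hb Q ⁻¹' {a}) = Fintype.card {j // zeroOfIndex hb Q j = a} :=
    Nat.card_eq_fintype_card (α := {j // zeroOfIndex hb Q j = a})
  rw [hcard, ← Finset.card_univ, ← Finset.sum_const]
  exact Finset.sum_congr rfl fun j _ => (hfib a j).symm

/-- If `h` is the least exponent for which the canonical product converges, then
`e^Q ∏ E_h(b_j z)` has genus `max (deg Q) h`. -/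
theorem hasGenus_exp_mul_canonicalProduct (hb : IsLeast {l | Summable fun j => ‖b j‖ ^ (l + 1)} h)
    (Q : Polynomial ℂ) :
    HasGenus (fun z => Complex.exp (Q.eval z) * canonicalProduct h b z) (max Q.natDegree h) := by
  have hs : Summable fun j => ‖b j‖ ^ (h + 1) := hb.1
  have hdiff : Differentiable ℂ fun z => Complex.exp (Q.eval z) * canonicalProduct h b z :=
    Q.differentiable.cexp.mul (differentiable_canonicalProduct hs)
  refine ⟨hdiff, h, Q, canonicalProduct h b, ?_, hasProd_zeros hs Q, fun z => ?_, rfl⟩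
  · have : {l | ZeroPowersSummable (fun z => Complex.exp (Q.eval z) * canonicalProduct h b z)
        (l + 1)} = {l | Summable fun j => ‖b j‖ ^ (l + 1)} := by
      ext l
      exact zeroPowersSummable_iff hs Q l.succ_ne_zero
    rwa [this]
  · have h0 : analyticOrderNatAt (fun z => Complex.exp (Q.eval z) * canonicalProduct h b z) 0
        = 0 := by
      rw [analyticOrderNatAt, (hdiff.analyticAt 0).analyticOrderAt_eq_zero.mpr, ENat.toNat_zero]
      rw [Ne, exp_mul_canonicalProduct_eq_zero_iff hs]
      simp
    rw [h0, pow_zero, one_mul]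

/-- A product `e^Q ∏ E_p(b_j z)` with `∑ |b_j|^p < ∞` and `deg Q ≤ p` is `e^{α z^p}` times a
function of genus at most `p - 1`. -/
theorem exists_hasGenus_of_summable_pow {p : ℕ} (hp : 0 < p) (hb : Summable fun j => ‖b j‖ ^ p)
    (Q : Polynomial ℂ) (hQ : Q.natDegree ≤ p) :
    ∃ (α : ℂ) (g : ℂ → ℂ),
      (∀ z, Complex.exp (Q.eval z) * canonicalProduct p b z = Complex.exp (α * z ^ p) * g z) ∧
      ∃ q ≤ p - 1, HasGenus g q := by
  classical
  have hne : ∃ l, Summable fun j => ‖b j‖ ^ (l + 1) := ⟨p - 1, by rwa [Nat.sub_add_cancel hp]⟩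
  set h := Nat.find hne with hh
  have hleast : IsLeast {l | Summable fun j => ‖b j‖ ^ (l + 1)} h :=
    ⟨Nat.find_spec hne, fun l hl => Nat.find_min' hne hl⟩
  have hhp : h ≤ p - 1 := Nat.find_min' hne (by rwa [Nat.sub_add_cancel hp])
  obtain ⟨Q₁, hQ₁, hprod⟩ := exists_canonicalProduct_eq_exp_mul (H := p) hleast.1 (by omega)
  set R := Q + Q₁ with hR
  have hRdeg : R.natDegree ≤ p := Polynomial.natDegree_add_le_of_degree_le hQ hQ₁
  -- Since `deg R ≤ p`, erasing the `z^p` term leaves degree at most `p - 1`.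
  refine ⟨R.coeff p, fun z => Complex.exp ((R.erase p).eval z) * canonicalProduct h b z,
    fun z => ?_, _, ?_, hasGenus_exp_mul_canonicalProduct hleast (R.erase p)⟩
  · have hRz : R.eval z = R.coeff p * z ^ p + (R.erase p).eval z := by
      conv_lhs => rw [← Polynomial.monomial_add_erase R p]
      rw [Polynomial.eval_add, Polynomial.eval_monomial]
    rw [hprod, ← mul_assoc, ← mul_assoc, ← Complex.exp_add, ← Complex.exp_add, ← hRz, hR,
      Polynomial.eval_add]
  · refine max_le ?_ hhp
    rw [Polynomial.natDegree_le_iff_coeff_eq_zero]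
    intro N hN
    rw [Polynomial.coeff_erase]
    split_ifs with hNp
    · rfl
    · exact Polynomial.coeff_eq_zero_of_natDegree_lt (by omega)

end Genus

/-! ### Coefficients and power sums of inverse roots. -/

namespace Polynomial

lemma iteratedDeriv_eval_zero (P : Polynomial ℂ) (k : ℕ) :
    (1 / (Nat.factorial k : ℂ)) * iteratedDeriv k (fun z => P.eval z) 0 = P.coeff k := by
  have : ∀ (k : ℕ) (P : Polynomial ℂ),
      deriv^[k] (fun z => P.eval z) = fun z => (derivative^[k] P).eval z := by
    intro k
    induction k with
    | zero => intro P; rfl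
    | succ k ih =>
      intro P
      have h1 : deriv (fun z => P.eval z) = fun z => (derivative P).eval z := by
        ext z; exact P.deriv
      rw [Function.iterate_succ_apply, Function.iterate_succ_apply, h1, ih]
  rw [iteratedDeriv_eq_iterate, this]
  simp only
  rw [← coeff_zero_eq_eval_zero, coeff_iterate_derivative, zero_add, Nat.descFactorial_self,
    nsmul_eq_mul]
  have : (Nat.factorial k : ℂ) ≠ 0 := by exact_mod_cast Nat.factorial_ne_zero k
  field_simp

/-- The multiset of the inverses of the roots of a polynomial. -/
noncomputable def invRoots (P : Polynomial ℂ) : Multiset ℂ := P.roots.map (·⁻¹)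

lemma eval_eq_mul_prod_invRoots {P : Polynomial ℂ} (hP : P.eval 0 ≠ 0) (z : ℂ) :
    P.eval z = P.eval 0 * (P.invRoots.map fun b => 1 - b * z).prod := by
  have hs := IsAlgClosed.splits P
  have hP0 : P ≠ 0 := by rintro rfl; simp at hP
  have h0 : ∀ a ∈ P.roots, a ≠ 0 := by
    rintro a ha rfl
    exact hP ((mem_roots hP0).mp ha)
  rw [hs.eval_eq_prod_roots z, hs.eval_eq_prod_roots 0, invRoots, Multiset.map_map, mul_assoc,
    ← Multiset.prod_map_mul]
  congr 2
  refine Multiset.map_congr rfl fun a ha => ?_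
  have := h0 a ha
  simp only [Function.comp]
  field_simp
  ring

lemma eq_C_mul_prod_invRoots {P : Polynomial ℂ} (hP : P.eval 0 ≠ 0) :
    P = C (P.eval 0) * (P.invRoots.map fun b => 1 - C b * X).prod := by
  refine Polynomial.funext fun z => ?_
  rw [eval_eq_mul_prod_invRoots hP z, eval_mul, eval_C, eval_multiset_prod, Multiset.map_map]
  simp

/-- The logarithmic derivative of `∏ (1 - b X)` generates the negatives of the power sums. -/
lemma derivative_prod_one_sub_mul_X (B : Multiset ℂ) :
    PowerSeries.derivative ℂ ((B.map fun b => 1 - C b * X).prod : Polynomial ℂ)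
      = -(((B.map fun b => 1 - C b * X).prod : Polynomial ℂ) : PowerSeries ℂ) *
        PowerSeries.mk fun k => (B.map fun b => b ^ (k + 1)).sum := by
  induction B using Multiset.induction_on with
  | empty =>
    have : (PowerSeries.mk fun _ => (0 : ℂ)) = 0 := by ext; simp
    simp [this]
  | cons b B ih =>
    set q : Polynomial ℂ := (B.map fun b => 1 - C b * X).prod with hq
    have hgeom : (1 - PowerSeries.C b * PowerSeries.X) * PowerSeries.mk (fun k => b ^ (k + 1))
        = PowerSeries.C b := by
      ext n
      rw [sub_mul, one_mul, mul_assoc, map_sub, PowerSeries.coeff_C_mul, PowerSeries.coeff_mk]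
      cases n with
      | zero => simp
      | succ n =>
        rw [PowerSeries.coeff_succ_X_mul, PowerSeries.coeff_mk, PowerSeries.coeff_C,
          if_neg n.succ_ne_zero]
        ring
    have hmk : (PowerSeries.mk fun k => ((b ::ₘ B).map fun b => b ^ (k + 1)).sum)
        = PowerSeries.mk (fun k => b ^ (k + 1)) +
          PowerSeries.mk fun k => (B.map fun b => b ^ (k + 1)).sum := by
      ext n; simp
    have hd : PowerSeries.derivative ℂ ((1 : PowerSeries ℂ) - PowerSeries.C b * PowerSeries.X)
        = -PowerSeries.C b := by
      ext n
      rw [PowerSeries.coeff_derivative]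
      cases n <;> simp [PowerSeries.coeff_C, PowerSeries.coeff_one]
    rw [Multiset.map_cons, Multiset.prod_cons, ← hq, hmk]
    simp only [coe_mul, coe_sub, coe_one, coe_C, coe_X]
    rw [Derivation.leibniz, ih, hd, smul_eq_mul, smul_eq_mul]
    linear_combination (q : PowerSeries ℂ) * hgeom

/-- Newton's identities. -/
lemma newton_identity_invRoots {P : Polynomial ℂ} (hP : P.eval 0 ≠ 0) (k : ℕ) :
    P.coeff (k + 1) * (k + 1) = -∑ x ∈ Finset.HasAntidiagonal.antidiagonal k,
      P.coeff x.1 * (P.invRoots.map fun b => b ^ (x.2 + 1)).sum := by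
  have h := derivative_prod_one_sub_mul_X P.invRoots
  have h2 : PowerSeries.derivative ℂ (P : PowerSeries ℂ) = -(P : PowerSeries ℂ) *
      PowerSeries.mk fun k => (P.invRoots.map fun b => b ^ (k + 1)).sum := by
    have hC : PowerSeries.derivative ℂ ((C (P.eval 0) : Polynomial ℂ) : PowerSeries ℂ) = 0 := by
      rw [PowerSeries.derivative_coe]; simp
    have hPQ := congrArg (fun q : Polynomial ℂ => (q : PowerSeries ℂ)) (eq_C_mul_prod_invRoots hP)
    simp only [coe_mul] at hPQ
    rw [hPQ, Derivation.leibniz, h, hC, smul_eq_mul, smul_eq_mul]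
    ring
  have h3 := congrArg (PowerSeries.coeff k) h2
  rw [PowerSeries.coeff_derivative, neg_mul, map_neg, PowerSeries.coeff_mul] at h3
  simpa using h3

/-- If the coefficients converge and the constant terms stay away from `0`, then the power sums of
the inverse roots converge. -/
lemma exists_tendsto_powerSum_invRoots {P : ℕ → Polynomial ℂ} (hP : ∀ n, (P n).eval 0 ≠ 0)
    {c : ℕ → ℂ} (hc : c 0 ≠ 0) (hlim : ∀ k, Tendsto (fun n => (P n).coeff k) atTop (𝓝 (c k)))
    (k : ℕ) : ∃ s, Tendsto (fun n => ((P n).invRoots.map fun b => b ^ (k + 1)).sum) atTop (𝓝 s) := by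
  induction k using Nat.strong_induction_on with
  | _ k ih =>
    -- The pair `(0, k)` carries the one new power sum, multiplied by the constant term; all others
    -- involve lower power sums, and the identity is then solved for the new one.
    have hsum : ∃ t, Tendsto (fun n => ∑ x ∈ (Finset.HasAntidiagonal.antidiagonal k).erase (0, k),
        (P n).coeff x.1 * ((P n).invRoots.map fun b => b ^ (x.2 + 1)).sum) atTop (𝓝 t) := by
      have : ∀ x ∈ (Finset.HasAntidiagonal.antidiagonal k).erase (0, k), ∃ t, Tendsto (fun n =>
          (P n).coeff x.1 * ((P n).invRoots.map fun b => b ^ (x.2 + 1)).sum) atTop (𝓝 t) := by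
        rintro ⟨i, j⟩ hx
        simp only [Finset.mem_erase, Finset.HasAntidiagonal.mem_antidiagonal, ne_eq, Prod.mk.injEq] at hx
        obtain ⟨s, hs⟩ := ih j (by omega)
        exact ⟨_, (hlim i).mul hs⟩
      choose! t ht using this
      exact ⟨_, tendsto_finsetSum _ ht⟩
    obtain ⟨t, ht⟩ := hsum
    refine ⟨(-(c (k + 1) * (k + 1)) - t) / c 0, ?_⟩
    refine Tendsto.congr (fun n => ?_)
      (((((hlim (k + 1)).mul_const ((k : ℂ) + 1)).neg).sub ht).div (hlim 0) hc)
    have h0 : (P n).coeff 0 ≠ 0 := by rw [coeff_zero_eq_eval_zero]; exact hP n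
    simp only [Pi.div_apply]
    rw [newton_identity_invRoots (hP n), neg_neg, ← Finset.add_sum_erase _ _
      (show (0, k) ∈ Finset.HasAntidiagonal.antidiagonal k by simp)]
    simp only [add_sub_cancel_right]
    field_simp

end Polynomial

/-! ### Polynomials as canonical products. -/

lemma Multiset.prod_one_sub_mul_eq (p : ℕ) (B : Multiset ℂ) (z : ℂ) :
    (B.map fun b => 1 - b * z).prod
      = Complex.exp (-∑ k ∈ Finset.Icc 1 p, (B.map fun b => b ^ k).sum * z ^ k / (k : ℂ)) *
        (B.map fun b => elementaryFactor p (b * z)).prod := by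
  induction B using Multiset.induction_on with
  | empty => simp
  | cons b B ih =>
    have : ∑ k ∈ Finset.Icc 1 p, ((b ::ₘ B).map fun b => b ^ k).sum * z ^ k / (k : ℂ)
        = ∑ k ∈ Finset.Icc 1 p, (b * z) ^ k / (k : ℂ) +
          ∑ k ∈ Finset.Icc 1 p, (B.map fun b => b ^ k).sum * z ^ k / (k : ℂ) := by
      rw [← Finset.sum_add_distrib]
      refine Finset.sum_congr rfl fun k _ => ?_
      rw [Multiset.map_cons, Multiset.sum_cons, mul_pow]
      ring
    rw [this, Multiset.map_cons, Multiset.prod_cons, Multiset.map_cons, Multiset.prod_cons, ih,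
      elementaryFactor, neg_add, Complex.exp_add]
    have hE := Complex.exp_neg (∑ k ∈ Finset.Icc 1 p, (b * z) ^ k / (k : ℂ))
    have hne := Complex.exp_ne_zero (∑ k ∈ Finset.Icc 1 p, (b * z) ^ k / (k : ℂ))
    rw [hE]
    field_simp

/-- A multiset of complex numbers can be listed by decreasing absolute value. -/
lemma Multiset.exists_antitone_norm_enumeration (B : Multiset ℂ) :
    ∃ b : ℕ → ℂ, B = (Multiset.range (Multiset.card B)).map b ∧
      (∀ j, Multiset.card B ≤ j → b j = 0) ∧ Antitone fun j => ‖b j‖ := by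
  classical
  set r : ℂ → ℂ → Prop := fun x y => ‖y‖ ≤ ‖x‖ with hr
  have : Std.Total r := ⟨fun x y => le_total _ _⟩
  have : IsTrans ℂ r := ⟨fun x y z hxy hyz => le_trans hyz hxy⟩
  set l := B.toList.insertionSort r with hl
  have hlB : (l : Multiset ℂ) = B := by
    rw [Multiset.coe_eq_coe.mpr (List.perm_insertionSort r _), Multiset.coe_toList]
  have hlen : l.length = Multiset.card B := by rw [← hlB, Multiset.coe_card]
  have hpair : l.Pairwise r := List.pairwise_insertionSort r _
  refine ⟨fun j => l.getD j 0, ?_, fun j hj => List.getD_eq_default _ _ (by omega), ?_⟩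
  · rw [← hlen, ← hlB, Multiset.range, Multiset.map_coe]
    congr 1
    refine List.ext_getElem (by simp) fun i h1 h2 => ?_
    simp [h1]
  · refine antitone_nat_of_succ_le fun j => ?_
    by_cases hj : j + 1 < l.length
    · simp only [List.getD_eq_getElem _ _ hj, List.getD_eq_getElem _ _ (Nat.lt_of_succ_lt hj)]
      exact List.pairwise_iff_getElem.mp hpair j (j + 1) _ hj (Nat.lt_succ_self j)
    · simp only [List.getD_eq_default l 0 (not_lt.mp hj), norm_zero]
      positivity

lemma Polynomial.exists_eval_eq_canonicalProduct {P : Polynomial ℂ} (hP : P.eval 0 ≠ 0) (p : ℕ)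
    (hp : 0 < p) {M : ℝ} (hM : absZeroPowerSum p P ≤ M) :
    ∃ b : ℕ → ℂ, (∀ N, ∑ j ∈ Finset.range N, ‖b j‖ ^ p ≤ M) ∧
      (∀ j : ℕ, (j + 1) * ‖b j‖ ^ p ≤ M) ∧
      ∀ z, P.eval z = P.eval 0 *
        Complex.exp (-∑ k ∈ Finset.Icc 1 p,
          (P.invRoots.map fun b => b ^ k).sum * z ^ k / (k : ℂ)) * canonicalProduct p b z := by
  obtain ⟨b, hbB, hb0, hanti⟩ := P.invRoots.exists_antitone_norm_enumeration
  set d := Multiset.card P.invRoots with hd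
  have htotal : ∑ j ∈ Finset.range d, ‖b j‖ ^ p ≤ M := by
    refine le_of_eq_of_le ?_ hM
    have : absZeroPowerSum p P = (P.invRoots.map fun b => ‖b‖ ^ p).sum := by
      rw [absZeroPowerSum, invRoots, Multiset.map_map]
      simp
    rw [this, hbB, Multiset.map_map]
    rfl
  have hsum : ∀ N, ∑ j ∈ Finset.range N, ‖b j‖ ^ p ≤ M := fun N => by
    refine le_trans ?_ htotal
    rcases le_total N d with hN | hN
    · exact Finset.sum_le_sum_of_subset_of_nonneg (Finset.range_mono hN)
        fun _ _ _ => by positivity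
    · refine (Finset.sum_subset (Finset.range_mono hN) fun j _ hj => ?_).ge
      rw [hb0 j (by simpa using hj), norm_zero, zero_pow hp.ne']
  refine ⟨b, hsum, fun j => ?_, fun z => ?_⟩
  · refine le_trans ?_ (hsum (j + 1))
    -- By monotonicity `b j` is the smallest of the first `j + 1` entries.
    have : ∑ i ∈ Finset.range (j + 1), ‖b j‖ ^ p ≤ ∑ i ∈ Finset.range (j + 1), ‖b i‖ ^ p :=
      Finset.sum_le_sum fun i hi => by
        gcongr
        exact hanti (Nat.lt_succ_iff.mp (Finset.mem_range.mp hi))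
    simpa using this
  · rw [eval_eq_mul_prod_invRoots hP, Multiset.prod_one_sub_mul_eq p, mul_assoc]
    congr 2
    have : canonicalProduct p b z = ∏ j ∈ Finset.range d, elementaryFactor p (b j * z) :=
      tprod_eq_prod fun j hj => by
        rw [hb0 j (by simpa using hj), zero_mul, elementaryFactor_zero]
    rw [this, hbB, Multiset.map_map]
    rfl

/-! ### From local bounds to strong convergence. -/

lemma Polynomial.hasSum_eval (P : Polynomial ℂ) (z : ℂ) :
    HasSum (fun k => P.coeff k * z ^ k) (P.eval z) := by
  rw [Polynomial.eval_eq_sum, Polynomial.sum_def]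
  refine hasSum_sum_of_ne_finset_zero fun k hk => ?_
  rw [Polynomial.notMem_support_iff.mp hk, zero_mul]

/-- Cauchy's estimates for a polynomial. -/
lemma Polynomial.norm_coeff_le {P : Polynomial ℂ} {r B : ℝ} (hr : 0 < r)
    (hB : ∀ z : ℂ, ‖z‖ ≤ r → ‖P.eval z‖ ≤ B) (k : ℕ) : ‖P.coeff k‖ ≤ B / r ^ k := by
  have h := Complex.norm_iteratedDeriv_le_of_forall_mem_sphere_norm_le (c := 0) k hr
    P.differentiable.diffContOnCl fun z hz => hB z (mem_sphere_zero_iff_norm.mp hz).le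
  have hk : (0 : ℝ) < Nat.factorial k := by exact_mod_cast Nat.factorial_pos k
  rw [← P.iteratedDeriv_eval_zero k, norm_mul, norm_div, norm_one, Complex.norm_natCast]
  calc _ ≤ 1 / (Nat.factorial k : ℝ) * (Nat.factorial k * B / r ^ k) := by gcongr
    _ = _ := by field_simp

/-- A locally bounded sequence of polynomials whose coefficients converge converges uniformly on
compact sets to an entire function. -/
lemma exists_convergesStrongly_of_locally_bounded {P : ℕ → Polynomial ℂ} {f : PowerSeries ℂ}
    (hlim : ∀ k, Tendsto (fun n => (P n).coeff k) atTop (𝓝 (PowerSeries.coeff k f)))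
    (hbd : ∀ R : ℝ, ∃ B : ℝ, ∀ n, ∀ z : ℂ, ‖z‖ ≤ R → ‖(P n).eval z‖ ≤ B) :
    ∃ F : ℂ → ℂ, RepresentsEntire f F ∧ ConvergesStrongly (fun n z => (P n).eval z) F := by
  have hcoeff : ∀ r : ℝ, 0 < r → ∃ B : ℝ, ∀ n k, ‖(P n).coeff k‖ ≤ B / r ^ k := fun r hr => by
    obtain ⟨B, hB⟩ := hbd r
    exact ⟨B, fun n k => Polynomial.norm_coeff_le hr (hB n) k⟩
  have hgeom : ∀ R : ℝ, 0 < R → ∃ u : ℕ → ℝ, Summable u ∧ ∀ n k, ‖(P n).coeff k‖ * R ^ k ≤ u k :=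
    fun R hR => by
      -- Cauchy's estimate on twice the radius leaves a geometric factor `2^(-k)`, uniform in `n`.
      obtain ⟨B, hB⟩ := hcoeff (2 * R) (by positivity)
      refine ⟨fun k => B * (1 / 2) ^ k, summable_geometric_two.mul_left B, fun n k => ?_⟩
      calc ‖(P n).coeff k‖ * R ^ k ≤ B / (2 * R) ^ k * R ^ k := by gcongr; exact hB n k
        _ = B * (1 / 2) ^ k := by
          rw [mul_pow, div_pow, one_pow]
          field_simp
  have hlimbd : ∀ R : ℝ, ∀ u : ℕ → ℝ, (∀ n k, ‖(P n).coeff k‖ * R ^ k ≤ u k) →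
      ∀ k, ‖PowerSeries.coeff k f‖ * R ^ k ≤ u k := fun R u hu k =>
    le_of_tendsto ((hlim k).norm.mul_const _) (Eventually.of_forall fun n => hu n k)
  have hsum : ∀ z : ℂ, Summable fun k => PowerSeries.coeff k f * z ^ k := fun z => by
    obtain ⟨u, hu, hub⟩ := hgeom (‖z‖ + 1) (by positivity)
    refine Summable.of_norm_bounded hu fun k => ?_
    rw [norm_mul, norm_pow]
    refine le_trans ?_ (hlimbd _ u hub k)
    gcongr
    linarith
  set F : ℂ → ℂ := fun z => ∑' k, PowerSeries.coeff k f * z ^ k with hF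
  have hstrong : ConvergesStrongly (fun n z => (P n).eval z) F := by
    intro K hK
    obtain ⟨R, hR0, hR⟩ := hK.isBounded.exists_pos_norm_le
    obtain ⟨u, hu, hub⟩ := hgeom R hR0
    have hbound : ∀ n k, ‖‖PowerSeries.coeff k f - (P n).coeff k‖ * R ^ k‖ ≤ 2 * u k := by
      intro n k
      rw [Real.norm_of_nonneg (by positivity)]
      calc ‖PowerSeries.coeff k f - (P n).coeff k‖ * R ^ k
          ≤ (‖PowerSeries.coeff k f‖ + ‖(P n).coeff k‖) * R ^ k := by
            gcongr
            exact norm_sub_le _ _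
        _ ≤ 2 * u k := by linarith [hub n k, hlimbd R u hub k]
    have htann : Tendsto (fun n => ∑' k, ‖PowerSeries.coeff k f - (P n).coeff k‖ * R ^ k) atTop
        (𝓝 (∑' _ : ℕ, (0 : ℝ))) := by
      refine tendsto_tsum_of_dominated_convergence (hu.mul_left 2) (fun k => ?_)
        (Eventually.of_forall hbound)
      simpa using (((hlim k).const_sub (PowerSeries.coeff k f)).norm.mul_const (R ^ k))
    rw [tsum_zero] at htann
    rw [Metric.tendstoUniformlyOn_iff]
    intro ε hε
    filter_upwards [htann.eventually_lt_const hε] with n hn z hz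
    refine lt_of_le_of_lt ?_ hn
    rw [dist_eq_norm, hF, ← ((hsum z).hasSum.sub ((P n).hasSum_eval z)).tsum_eq]
    refine tsum_of_norm_bounded (Summable.of_norm_bounded (hu.mul_left 2) (hbound n)).hasSum
      fun k => ?_
    rw [← sub_mul, norm_mul, norm_pow]
    gcongr
    exact hR z hz
  refine ⟨F, ⟨?_, fun z => (hsum z).hasSum⟩, hstrong⟩
  rw [← differentiableOn_univ]
  refine TendstoLocallyUniformlyOn.differentiableOn (φ := atTop)
    (F := fun n z => (P n).eval z) ?_ (Eventually.of_forall fun n =>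
      (P n).differentiable.differentiableOn) isOpen_univ
  rw [tendstoLocallyUniformlyOn_iff_forall_isCompact isOpen_univ]
  exact fun K _ hK => hstrong K hK

/-! ### Uniform bounds, and the theorem. -/

/-- The sequences with `(j + 1) |b_j|^p ≤ M` have a common majorant, namely `(M / (j + 1))^(1/p)`,
which is summable in the power `p + 1`. -/
lemma exists_summable_majorant {p : ℕ} {M : ℝ} (hp : 0 < p) (hM : 0 < M) :
    ∃ v : ℕ → ℝ, (∀ j, 0 ≤ v j) ∧ (Summable fun j => v j ^ (p + 1)) ∧
      ∀ (b : ℕ → ℂ), (∀ j : ℕ, (j + 1) * ‖b j‖ ^ p ≤ M) → ∀ j, ‖b j‖ ≤ v j := by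
  have hp' : (0 : ℝ) < p := by exact_mod_cast hp
  refine ⟨fun j => (M / (j + 1)) ^ (1 / p : ℝ), fun j => by positivity, ?_, fun b hb j => ?_⟩
  · have h1 : Summable fun j : ℕ =>
        M ^ ((p + 1) / p : ℝ) * (1 / ((j + 1 : ℕ) : ℝ) ^ ((p + 1) / p : ℝ)) := by
      refine Summable.mul_left _ ?_
      refine (summable_nat_add_iff (f := fun j : ℕ => 1 / (j : ℝ) ^ ((p + 1) / p : ℝ)) 1).mpr ?_
      rw [Real.summable_one_div_nat_rpow, lt_div_iff₀ hp']
      linarith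
    refine h1.congr fun j => ?_
    rw [← Real.rpow_natCast, ← Real.rpow_mul (by positivity), Real.div_rpow hM.le (by positivity)]
    push_cast
    rw [one_div_mul_eq_div, mul_one_div]
  · have h1 : ‖b j‖ ^ p ≤ M / (j + 1) := by
      rw [le_div_iff₀ (by positivity), mul_comm]
      exact hb j
    calc ‖b j‖ = (‖b j‖ ^ p) ^ (1 / p : ℝ) := by
          rw [one_div, Real.pow_rpow_inv_natCast (norm_nonneg _) hp.ne']
      _ ≤ (M / (j + 1)) ^ (1 / p : ℝ) := by gcongr

lemma norm_canonicalProduct_le {b : ℕ → ℂ} {h : ℕ} {u : ℕ → ℝ} {z : ℂ}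
    (hb : Summable fun j => ‖b j‖ ^ (h + 1)) (hu : Summable u)
    (hub : ∀ j, ‖elementaryFactor h (b j * z) - 1‖ ≤ u j) :
    ‖canonicalProduct h b z‖ ≤ Real.exp (∑' j, u j) := by
  refine le_of_tendsto (hasProd_canonicalProduct hb z).norm (Eventually.of_forall fun s => ?_)
  have h1 := s.norm_prod_one_add_sub_one_le fun j => elementaryFactor h (b j * z) - 1
  simp only [add_sub_cancel] at h1
  have h2 : ∑ j ∈ s, ‖elementaryFactor h (b j * z) - 1‖ ≤ ∑' j, u j :=
    (Finset.sum_le_sum fun j _ => hub j).trans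
      (hu.sum_le_tsum s fun j _ => (norm_nonneg _).trans (hub j))
  have h3 := Real.exp_le_exp.mpr h2
  have h4 := norm_sub_norm_le (∏ j ∈ s, elementaryFactor h (b j * z)) 1
  rw [norm_one] at h4
  rw [← norm_prod]
  linarith

theorem theorem2p3 (p : ℕ) (hp : 0 < p) (M : ℝ) (hM : 0 < M)
    (P : ℕ → Polynomial ℂ) (f : PowerSeries ℂ) (c : ℂ)
    (hP0 : ∀ n, (P n).eval 0 ≠ 0)
    (hc : c ≠ 0) (hlim : Tendsto (fun n => (P n).eval 0) atTop (𝓝 c))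
    (hweak : ConvergesWeakly (fun n z => (P n).eval z) f)
    (hbound : ∀ n, absZeroPowerSum p (P n) ≤ M) :
    ∃ F : ℂ → ℂ,
      RepresentsEntire f F ∧
      ConvergesStrongly (fun n z => (P n).eval z) F ∧
      ∃ (α : ℂ) (g : ℂ → ℂ),
        (∀ z : ℂ, F z = Complex.exp (α * z ^ p) * g z) ∧
        ∃ q : ℕ, q ≤ p - 1 ∧ HasGenus g q := by
  have hcoeff : ∀ k, Tendsto (fun n => (P n).coeff k) atTop (𝓝 (PowerSeries.coeff k f)) :=
    fun k => (hweak k).congr fun n => (P n).iteratedDeriv_eval_zero k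
  have hc0 : PowerSeries.coeff 0 f = c :=
    tendsto_nhds_unique (hcoeff 0) (by simpa only [Polynomial.coeff_zero_eq_eval_zero] using hlim)
  -- The zeroth power sum is the degree, which may diverge; the value at `k = 0` is a dummy.
  have hpow : ∀ k, ∃ s, k ≠ 0 →
      Tendsto (fun n => ((P n).invRoots.map fun b => b ^ k).sum) atTop (𝓝 s) := fun k => by
    rcases k with _ | k
    · exact ⟨0, fun h => absurd rfl h⟩
    · obtain ⟨s, hs⟩ := Polynomial.exists_tendsto_powerSum_invRoots hP0
        (c := fun k => PowerSeries.coeff k f) (by rwa [hc0]) hcoeff k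
      exact ⟨s, fun _ => hs⟩
  choose σ hσ using hpow
  choose b hbsum hbdecay hbprod using fun n =>
    Polynomial.exists_eval_eq_canonicalProduct (hP0 n) p hp (hbound n)
  obtain ⟨v, hv0, hvsum, hv⟩ := exists_summable_majorant hp hM
  have hbv : ∀ n j, ‖b n j‖ ≤ v j := fun n => hv (b n) (hbdecay n)
  have hbs : ∀ n, Summable fun j => ‖b n j‖ ^ (p + 1) := fun n =>
    Summable.of_nonneg_of_le (fun _ => by positivity)
      (fun j => by gcongr; exact hbv n j) hvsum
  have hvnorm : ∀ j, ‖(v j : ℂ)‖ = v j := fun j => by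
    rw [Complex.norm_real, Real.norm_of_nonneg (hv0 j)]
  have hmajorant : ∀ R : ℝ, ∃ u : ℕ → ℝ, Summable u ∧ ∀ n j, ∀ z : ℂ, ‖z‖ ≤ R →
      ‖elementaryFactor p (b n j * z) - 1‖ ≤ u j := fun R => by
    obtain ⟨u, hu, hub⟩ := exists_summable_bound_elementaryFactor (b := fun j => (v j : ℂ))
      (h := p) (by simpa only [hvnorm] using hvsum) R
    refine ⟨u, hu, fun n j z hz => hub j _ ?_⟩
    rw [norm_mul, hvnorm]
    exact mul_le_mul (hbv n j) (hz.trans (le_abs_self R)) (norm_nonneg _) (hv0 j)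
  have hbd : ∀ R : ℝ, ∃ B : ℝ, ∀ n, ∀ z : ℂ, ‖z‖ ≤ R → ‖(P n).eval z‖ ≤ B := fun R => by
    have hs : ∀ k, ∃ S : ℝ, k ≠ 0 → ∀ n, ‖((P n).invRoots.map fun b => b ^ k).sum‖ ≤ S :=
      fun k => by
        by_cases hk : k = 0
        · exact ⟨0, fun h => absurd hk h⟩
        · obtain ⟨S, hS⟩ := (hσ k hk).norm.bddAbove_range
          exact ⟨S, fun _ n => hS (Set.mem_range_self n)⟩
    choose S hS using hs
    obtain ⟨B₀, hB₀⟩ := hlim.norm.bddAbove_range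
    obtain ⟨u, hu, hub⟩ := hmajorant R
    refine ⟨B₀ * Real.exp (∑ k ∈ Finset.Icc 1 p, S k * R ^ k / k) * Real.exp (∑' j, u j),
      fun n z hz => ?_⟩
    have hB₀n : ‖(P n).eval 0‖ ≤ B₀ := hB₀ (Set.mem_range_self n)
    have hB₀' : 0 ≤ B₀ := (norm_nonneg _).trans hB₀n
    rw [hbprod n z, norm_mul, norm_mul]
    refine mul_le_mul (mul_le_mul hB₀n ?_ (norm_nonneg _) hB₀')
      (norm_canonicalProduct_le (hbs n) hu fun j => hub n j z hz) (norm_nonneg _) (by positivity)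
    refine (Complex.norm_exp_le_exp_norm _).trans (Real.exp_le_exp.mpr ?_)
    rw [norm_neg]
    refine norm_sum_le_of_le _ fun k hk => ?_
    have hk0 : k ≠ 0 := by have := (Finset.mem_Icc.mp hk).1; omega
    have hS0 : 0 ≤ S k := (norm_nonneg _).trans (hS k hk0 n)
    rw [norm_div, norm_mul, norm_pow, Complex.norm_natCast]
    gcongr
    exact hS k hk0 n
  obtain ⟨F, hF, hstrong⟩ := exists_convergesStrongly_of_locally_bounded hcoeff hbd
  refine ⟨F, hF, hstrong, ?_⟩
  have hcompact : IsCompact (Set.univ.pi fun j => Metric.closedBall (0 : ℂ) (v j)) :=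
    isCompact_univ_pi fun j => isCompact_closedBall 0 (v j)
  -- Tychonoff replaces a diagonal argument: a countable product of closed discs is sequentially
  -- compact.
  obtain ⟨β, -, φ, hφ, hβ⟩ := hcompact.tendsto_subseq (x := b)
    fun n j _ => mem_closedBall_zero_iff.mpr (hbv n j)
  have hβj : ∀ j, Tendsto (fun n => b (φ n) j) atTop (𝓝 (β j)) := fun j =>
    tendsto_pi_nhds.mp hβ j
  -- As in Fatou's lemma, each finite partial sum keeps the bound `M` in the limit.
  have hβsum : Summable fun j => ‖β j‖ ^ p := by
    refine summable_of_sum_range_le (c := M) (fun j => by positivity) fun N => ?_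
    exact le_of_tendsto (tendsto_finsetSum _ fun j _ => (hβj j).norm.pow p)
      (Eventually.of_forall fun n => hbsum (φ n) N)
  -- The constant `c ≠ 0` is absorbed as `exp (log c)`; the other terms come from the limits `σ k`
  -- of the power sums.
  set Q : Polynomial ℂ := Polynomial.C (Complex.log c) +
    ∑ k ∈ Finset.Icc 1 p, Polynomial.monomial k (-(σ k / k)) with hQ
  have hQdeg : Q.natDegree ≤ p := by
    refine Polynomial.natDegree_add_le_of_degree_le (by simp) ?_
    refine Polynomial.natDegree_sum_le_of_forall_le _ _ fun k hk => ?_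
    exact (Polynomial.natDegree_monomial_le _).trans (Finset.mem_Icc.mp hk).2
  have hFeq : ∀ z, F z = Complex.exp (Q.eval z) * canonicalProduct p β z := fun z => by
    have hlim1 : Tendsto (fun n => (P (φ n)).eval z) atTop (𝓝 (F z)) :=
      ((hstrong {z} isCompact_singleton).tendsto_at (Set.mem_singleton z)).comp hφ.tendsto_atTop
    obtain ⟨u, hu, hub⟩ := hmajorant ‖z‖
    have hprod : Tendsto (fun n => canonicalProduct p (b (φ n)) z) atTop
        (𝓝 (canonicalProduct p β z)) := by
      simp only [canonicalProduct_eq_tprod_one_add]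
      refine tendsto_tprod_one_add_of_dominated_convergence hu (fun j => ?_)
        (Eventually.of_forall fun n j => hub (φ n) j z le_rfl)
      exact (((differentiable_elementaryFactor p).continuous.tendsto _).comp
        ((hβj j).mul_const z)).sub_const 1
    have hexp : Tendsto (fun n => Complex.exp (-∑ k ∈ Finset.Icc 1 p,
        ((P (φ n)).invRoots.map fun b => b ^ k).sum * z ^ k / (k : ℂ))) atTop
        (𝓝 (Complex.exp (-∑ k ∈ Finset.Icc 1 p, σ k * z ^ k / (k : ℂ)))) := by
      refine (Complex.continuous_exp.tendsto _).comp
        (Tendsto.neg (tendsto_finsetSum _ fun k hk => ?_))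
      have hk0 : k ≠ 0 := by have := (Finset.mem_Icc.mp hk).1; omega
      exact (((hσ k hk0).comp hφ.tendsto_atTop).mul_const _).div_const _
    have hlim2 := ((hlim.comp hφ.tendsto_atTop).mul hexp).mul hprod
    rw [tendsto_nhds_unique hlim1 (hlim2.congr fun n => (hbprod (φ n) z).symm), hQ,
      Polynomial.eval_add, Polynomial.eval_C, Complex.exp_add, Complex.exp_log hc,
      Polynomial.eval_finsetSum, ← Finset.sum_neg_distrib]
    congr 3
    refine Finset.sum_congr rfl fun k _ => ?_
    rw [Polynomial.eval_monomial]
    ring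
  obtain ⟨α, g, hαg, hg⟩ := exists_hasGenus_of_summable_pow hp hβsum Q hQdeg
  exact ⟨α, g, fun z => (hFeq z).trans (hαg z), hg⟩
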